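/- Let $\mathcal S$ (nonempty) and $\mathcal A$ be finite sets, $r_{\max}\in\mathbb R$, and $\Delta_S$ the probability simplex over $\mathcal S$. For every $(s,a)\in\mathcal S\times\mathcal A$ let $B_r(s,a)\subseteq[0,r_{\max}]$ and $B_p(s,a)\subseteq\Delta_S$ be polytopes (convex hulls of finitely many points), and let $$\mathcal M=\{M=(\mathcal S,\mathcal A,r,p)\;:\; r(s,a)\in B_r(s,a),\ p(\cdot|s,a)\in B_p(s,a)\ \ \forall (s,a)\in\mathcal S\times\mathcal A\}$$ be the associated bounded-parameter MDP, where $r(s,a)$ is the mean reward and $p(\cdot|s,a)$ the transition distribution of $M$. Suppose that $M\in\mathcal M$ is an ergodic MDP, i.e. under every deterministic stationary policy the induced Markov chain on $\mathcal S$ consists of a single recurrent class (it is irreducible). Let $\pi:\mathcal S\to\mathcal A$ be a deterministic stationary policy, and for $v\in\mathbb R^{\mathcal S}$ let $$\mathcal L_\pi v(s)=\min_{r\in B_r(s,\pi(s))} r+\min_{p\in B_p(s,\pi(s))}p^{\mathsf T}v,\qquad s\in\mathcal S.$$ Then: 1. There exists $(\tilde g,\tilde h)\in\mathbb R\times\mathbb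 R^{\mathcal S}$ such that $\tilde g+\tilde h(s)=\mathcal L_\pi\tilde h(s)$ for all $s\in\mathcal S$. 2. The gain $g^\pi(M)=\lim_{T\to\infty}\mathbb E^\pi_{M}\big[\frac1T\sum_{t=1}^T r(s_t,\pi(s_t))\,\big|\,s_1=s\big]$ exists and does not depend on the initial state $s$, and every pair $(\tilde g,\tilde h)$ as in 1 satisfies $$\tilde g\le g^\pi(M)\qquad\text{and}\qquad sp(\tilde h):=\max_s\tilde h(s)-\min_s\tilde h(s)\le r_{\max}\,\Upsilon,$$ where $$\Upsilon:=\max_{\pi'}\ \max_{s\ne s'}\ \mathbb E^{\pi'}_M\big[\tau(s')\,\big|\,s\big]<+\infty ;$$ here $\pi'$ ranges over all deterministic stationary policies, $\tau(s')$ is the minimal number of steps to reach $s'$, and the maximum over an empty set of pairs is $0$. (In particular $sp(\tilde h)\le\Upsilon$ when $r_{\max}\le1$.) -/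

import Mathlib

open MeasureTheory ProbabilityTheory Filter Topology
open scoped ENNReal

/-- A finite Markov decision process with state space `S` and action space `A`: the mean rewards
`r s a` and the transition probabilities `p s a`, where `p s a s'` is the probability of moving
to `s'` when action `a` is played in state `s`. -/
structure FiniteMDP (S A : Type*) [Fintype S] where
  /-- mean reward -/
  r : S → A → ℝ
  /-- transition probabilities -/
  p : S → A → S → ℝ
  p_mem : ∀ s a, p s a ∈ stdSimplex ℝ S

namespace FiniteMDP

variable {S A : Type*} [Fintype S]

/-- The distribution of the next state, as a probability mass function. -/
noncomputable def nextState (M : FiniteMDP S A) (s : S) (a : A) : PMF S :=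
  PMF.ofFintype (fun s' => ENNReal.ofReal (M.p s a s')) (by
    rw [← ENNReal.ofReal_sum_of_nonneg (fun i _ => (M.p_mem s a).1 i), (M.p_mem s a).2,
      ENNReal.ofReal_one])

/-- The transition matrix of the Markov chain induced by a deterministic stationary policy. -/
def transitionMatrix (M : FiniteMDP S A) (π : S → A) : Matrix S S ℝ :=
  Matrix.of fun s s' => M.p s (π s) s'

/-- An MDP is ergodic if, under every deterministic stationary policy, the induced Markov chain
consists of a single recurrent class, i.e. its transition matrix is irreducible. -/
def IsErgodic (M : FiniteMDP S A) : Prop :=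
  ∀ π : S → A, (M.transitionMatrix π).IsIrreducible

section Trajectories

variable [MeasurableSpace S] [DiscreteMeasurableSpace S]

/-- The transition kernel of the Markov chain induced by a deterministic stationary policy. -/
noncomputable def chainKernel (M : FiniteMDP S A) (π : S → A) : Kernel S S where
  toFun s := (M.nextState s (π s)).toMeasure
  measurable' := Measurable.of_discrete

instance (M : FiniteMDP S A) (π : S → A) : IsMarkovKernel (M.chainKernel π) :=
  ⟨fun s => by change IsProbabilityMeasure (M.nextState s (π s)).toMeasure; infer_instance⟩

/-- The conditional law of the state at time `n + 1` given the states at times `0, …, n`: it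
depends on the state at time `n` only. -/
noncomputable def stepKernel (M : FiniteMDP S A) (π : S → A) (n : ℕ) :
    Kernel (Π _ : Finset.Iic n, S) S :=
  (M.chainKernel π).comap (fun x => x ⟨n, Finset.mem_Iic.2 le_rfl⟩) (measurable_pi_apply _)

instance (M : FiniteMDP S A) (π : S → A) (n : ℕ) : IsMarkovKernel (M.stepKernel π n) := by
  unfold stepKernel; infer_instance

/-- The law of the state trajectory `(s_0, s_1, …)` generated by the policy `π` in `M` from the
initial state `s_0 = s`. -/
noncomputable def trajMeasure (M : FiniteMDP S A) (π : S → A) (s : S) : Measure (ℕ → S) :=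
  Kernel.traj (X := fun _ => S) (M.stepKernel π) 0 (fun _ => s)

/-- `M.HasGain π g`: in the MDP `M`, the deterministic stationary policy `π` has (constant) gain
`g`, i.e. from every initial state its expected average reward over `T` steps converges to `g` as
`T → ∞`. -/
def HasGain (M : FiniteMDP S A) (π : S → A) (g : ℝ) : Prop :=
  ∀ s, Tendsto
    (fun T : ℕ => ∫ ω, (1 / (T : ℝ)) * ∑ t ∈ Finset.range T, M.r (ω t) (π (ω t))
      ∂(M.trajMeasure π s))
    atTop (𝓝 g)

/-- The expectation of the hitting time `τ(s')`, the minimal number of steps needed to reach `s'`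
(infinite on trajectories that never reach it), under policy `π` in `M`, from state `s`. -/
noncomputable def expectedHittingTime (M : FiniteMDP S A) (π : S → A) (s s' : S) : ℝ≥0∞ :=
  ∫⁻ ω, ENat.toENNReal (hittingAfter (fun (n : ℕ) (ω : ℕ → S) => ω n) {s'} 0 ω)
    ∂(M.trajMeasure π s)

/-- The worst-case diameter of `M`: the largest expected hitting time over all deterministic
stationary policies and all pairs of distinct states. -/
noncomputable def worstDiameter (M : FiniteMDP S A) : ℝ≥0∞ :=
  ⨆ (π : S → A) (s : S) (s' : S) (_ : s ≠ s'), M.expectedHittingTime π s s'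

end Trajectories

end FiniteMDP

/-- A (convex) polytope: the convex hull of finitely many points. -/
def IsPolytope {E : Type*} [AddCommGroup E] [Module ℝ E] (P : Set E) : Prop :=
  ∃ F : Set E, F.Finite ∧ P = convexHull ℝ F

/-- The data of a bounded-parameter MDP: polytope confidence sets `Br s a ⊆ [0, rmax]` for the
mean rewards and `Bp s a ⊆ Δ_S` for the transition probabilities. -/
structure BoundedParameterMDP (S A : Type*) [Fintype S] where
  rmax : ℝ
  /-- confidence sets for the rewards -/
  Br : S → A → Set ℝ
  /-- confidence sets for the transition probabilities -/
  Bp : S → A → Set (S → ℝ)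
  Br_subset : ∀ s a, Br s a ⊆ Set.Icc 0 rmax
  Bp_subset : ∀ s a, Bp s a ⊆ stdSimplex ℝ S
  Br_polytope : ∀ s a, IsPolytope (Br s a)
  Bp_polytope : ∀ s a, IsPolytope (Bp s a)

namespace BoundedParameterMDP

variable {S A : Type*} [Fintype S]

/-- The set of MDPs whose rewards and transition probabilities all lie in the confidence sets. -/
def models (B : BoundedParameterMDP S A) : Set (FiniteMDP S A) :=
  {M | ∀ s a, M.r s a ∈ B.Br s a ∧ M.p s a ∈ B.Bp s a}

/-- The pessimistic extended Bellman operator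
`L_π v (s) = min {r | r ∈ Br s (π s)} + min {pᵀ v | p ∈ Bp s (π s)}`.
Polytopes are compact, so each infimum is a minimum when the confidence sets are nonempty. -/
noncomputable def bellman (B : BoundedParameterMDP S A) (π : S → A) (v : S → ℝ) : S → ℝ :=
  fun s => sInf (B.Br s (π s)) + sInf ((fun p : S → ℝ => p ⬝ᵥ v) '' B.Bp s (π s))

end BoundedParameterMDP

/-- The span `max_s v(s) - min_s v(s)` of a vector. -/
noncomputable def vecSpan {S : Type*} (v : S → ℝ) : ℝ := (⨆ s, v s) - ⨅ s, v s

/-! Everything rests on the maximum principle for irreducible stochastic matrices. It makes the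
first-step equations of the hitting time of `s₀` uniquely solvable by some `u ≥ 0`, and a function
`f` with `f ≤ c + P f` off `s₀` then satisfies `f - f s₀ ≤ c * u`. Since `M` is a model, the minimum
over `Bp` is at most the average under the row of `M`. The discounted fixed points therefore satisfy
this drift bound with `c = rmax`, so their spans are bounded uniformly in the discount factor.
Compactness yields a limit as the discount tends to 1, which solves the undiscounted equation. Any
solution `(g, h)` has `g ≥ 0`, so `h` obeys the same drift bound; identifying `u` with the expected
hitting time bounds its span. The Poisson equation of `M` is the case of singleton confidence sets.
Telescoping it gives the gain, and comparing the two equations at a maximiser of `h - h'` gives `g ≤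
g'`. -/

section StochasticMatrix

variable {S : Type*} [Fintype S]

/-! ### Stochastic averages, the maximum principle and first-step equations. -/

theorem dotProduct_le_of_mem_stdSimplex {p f : S → ℝ} {c : ℝ} (hp : p ∈ stdSimplex ℝ S)
    (hf : ∀ s, f s ≤ c) : p ⬝ᵥ f ≤ c := by
  calc p ⬝ᵥ f ≤ ∑ s, p s * c := Finset.sum_le_sum fun s _ =>
        mul_le_mul_of_nonneg_left (hf s) (hp.1 s)
    _ = c := by rw [← Finset.sum_mul, hp.2, one_mul]

theorem le_dotProduct_of_mem_stdSimplex {p f : S → ℝ} {c : ℝ} (hp : p ∈ stdSimplex ℝ S)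
    (hf : ∀ s, c ≤ f s) : c ≤ p ⬝ᵥ f := by
  calc c = ∑ s, p s * c := by rw [← Finset.sum_mul, hp.2, one_mul]
    _ ≤ p ⬝ᵥ f := Finset.sum_le_sum fun s _ => mul_le_mul_of_nonneg_left (hf s) (hp.1 s)

theorem dotProduct_const_of_mem_stdSimplex {p : S → ℝ} (hp : p ∈ stdSimplex ℝ S) (c : ℝ) :
    p ⬝ᵥ (fun _ => c) = c := by
  simp only [dotProduct]
  rw [← Finset.sum_mul, hp.2, one_mul]

theorem abs_dotProduct_le_of_mem_stdSimplex {p : S → ℝ} (hp : p ∈ stdSimplex ℝ S) (f : S → ℝ) :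
    |p ⬝ᵥ f| ≤ ‖f‖ :=
  abs_le.2 ⟨le_dotProduct_of_mem_stdSimplex hp fun s => (abs_le.1 (norm_le_pi_norm f s)).1,
    dotProduct_le_of_mem_stdSimplex hp fun s => (abs_le.1 (norm_le_pi_norm f s)).2⟩

variable {P : Matrix S S ℝ}

/-- Maximum principle: a function that is subharmonic off `s₀` attains its maximum at `s₀`. -/
theorem Matrix.IsIrreducible.le_of_le_mulVec (hirr : P.IsIrreducible)
    (hP : ∀ s, P s ∈ stdSimplex ℝ S) {s₀ : S} {f : S → ℝ}
    (hf : ∀ s, s ≠ s₀ → f s ≤ (P.mulVec f) s) (s : S) : f s ≤ f s₀ := by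
  have : Nonempty S := ⟨s⟩
  obtain ⟨m, hm⟩ := Finite.exists_max f
  refine (hm s).trans ?_
  by_contra! hlt
  let : Quiver S := Matrix.toQuiver P
  obtain ⟨q, -⟩ := hirr.connected m s₀
  -- The maximum propagates along positive-probability edges, since one strictly smaller successor
  -- would pull the average below it. A path to `s₀` then contradicts `hlt`.
  have key : ∀ b, Quiver.Path m b → f b = f m := by
    intro b q
    induction q with
    | nil => rfl
    | @cons b c _ e ih =>
      have he : 0 < P b c := e.down
      have hb : b ≠ s₀ := by rintro rfl; exact hlt.ne ih
      refine (hm c).antisymm ?_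
      by_contra! hc
      have h1 : (P.mulVec f) b < ∑ j, P b j * f m :=
        Finset.sum_lt_sum (fun j _ => mul_le_mul_of_nonneg_left (hm j) ((hP b).1 j))
          ⟨c, Finset.mem_univ _, mul_lt_mul_of_pos_left hc he⟩
      rw [← Finset.sum_mul, (hP b).2, one_mul] at h1
      linarith [hf b hb]
  exact hlt.ne (key s₀ q)

/-- The first-step equations of the mean hitting time of `s₀` have a nonnegative solution. -/
theorem Matrix.IsIrreducible.exists_hittingTime_solution (hirr : P.IsIrreducible)
    (hP : ∀ s, P s ∈ stdSimplex ℝ S) (s₀ : S) :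
    ∃ u : S → ℝ, u s₀ = 0 ∧ (∀ s, 0 ≤ u s) ∧ ∀ s, s ≠ s₀ → u s = 1 + (P.mulVec u) s := by
  classical
  -- The maximum principle, applied to `f` and `-f`, shows that `T` is injective, hence surjective
  -- in finite dimension.
  let T : (S → ℝ) →ₗ[ℝ] (S → ℝ) :=
    { toFun := fun f s => if s = s₀ then f s else f s - (P.mulVec f) s
      map_add' := fun f g => by
        ext s
        simp only [Matrix.mulVec_add, Pi.add_apply]
        split_ifs <;> ring
      map_smul' := fun c f => by
        ext s
        simp only [Matrix.mulVec_smul, Pi.smul_apply, smul_eq_mul, RingHom.id_apply]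
        split_ifs <;> ring }
  have hT : ∀ f s, T f s = if s = s₀ then f s else f s - (P.mulVec f) s := fun _ _ => rfl
  have hinj : Function.Injective T := by
    rw [injective_iff_map_eq_zero]
    intro f hf
    have h0 : f s₀ = 0 := by simpa [hT] using congrFun hf s₀
    have h1 : ∀ s, s ≠ s₀ → f s = (P.mulVec f) s := fun s hs => by
      have := congrFun hf s
      rw [hT, if_neg hs, Pi.zero_apply] at this
      linarith
    ext s
    have h2 := hirr.le_of_le_mulVec hP (fun s hs => (h1 s hs).le) s
    have h3 := hirr.le_of_le_mulVec hP (s₀ := s₀) (f := -f)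
      (fun s hs => by rw [Matrix.mulVec_neg, Pi.neg_apply, Pi.neg_apply, h1 s hs]) s
    simp only [Pi.neg_apply, Pi.zero_apply] at *
    linarith
  obtain ⟨u, hu⟩ := LinearMap.injective_iff_surjective.1 hinj (fun s => if s = s₀ then 0 else 1)
  have h0 : u s₀ = 0 := by simpa [hT] using congrFun hu s₀
  have h1 : ∀ s, s ≠ s₀ → u s = 1 + (P.mulVec u) s := fun s hs => by
    have := congrFun hu s
    rw [hT, if_neg hs, if_neg hs] at this
    linarith
  refine ⟨u, h0, fun s => ?_, h1⟩
  have h3 := hirr.le_of_le_mulVec hP (s₀ := s₀) (f := -u)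
    (fun s hs => by
      rw [Matrix.mulVec_neg, Pi.neg_apply, Pi.neg_apply, h1 s hs]
      linarith) s
  simp only [Pi.neg_apply] at h3
  linarith

/-- A function whose drift off `s₀` is at most `c` exceeds its value at `s₀` by at most `c` times
the mean hitting time. -/
theorem Matrix.IsIrreducible.sub_le_mul_hittingTime (hirr : P.IsIrreducible)
    (hP : ∀ s, P s ∈ stdSimplex ℝ S) {s₀ : S} {u f : S → ℝ} {c : ℝ} (hu₀ : u s₀ = 0)
    (hu : ∀ s, s ≠ s₀ → u s = 1 + (P.mulVec u) s)
    (hf : ∀ s, s ≠ s₀ → f s ≤ c + (P.mulVec f) s) (s : S) : f s - f s₀ ≤ c * u s := by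
  -- Subtracting `c • u` cancels the drift and leaves a function subharmonic off `s₀`.
  have h := hirr.le_of_le_mulVec hP (s₀ := s₀) (f := f - c • u)
    (fun s hs => by
      rw [Matrix.mulVec_sub, Matrix.mulVec_smul]
      simp only [Pi.sub_apply, Pi.smul_apply, smul_eq_mul]
      linarith [hf s hs, congrArg (c * ·) (hu s hs)]) s
  simp only [Pi.sub_apply, Pi.smul_apply, smul_eq_mul, hu₀] at h
  linarith

end StochasticMatrix

/-- The hitting time is the number of times at which the target has not been reached yet. -/
theorem toENNReal_hittingAfter_eq_tsum {S : Type*} (s₀ : S) (ω : ℕ → S) :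
    ENat.toENNReal (hittingAfter (fun (n : ℕ) (ω : ℕ → S) => ω n) {s₀} 0 ω) =
      ∑' n, Set.indicator {ω : ℕ → S | ∀ i ≤ n, ω i ≠ s₀} (fun _ => (1 : ℝ≥0∞)) ω := by
  classical
  rw [hittingAfter_def]
  by_cases h : ∃ j, ω j = s₀
  · have e : sInf {i : ℕ | 0 ≤ i ∧ ω i ∈ ({s₀} : Set S)} = Nat.find h := by
      rw [← Nat.sInf_def h]; simp; rfl
    have h' : ∃ j, 0 ≤ j ∧ ω j ∈ ({s₀} : Set S) := by simpa using h
    dsimp only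
    rw [if_pos h', e, tsum_eq_sum (s := Finset.range (Nat.find h))]
    · rw [Finset.sum_congr rfl (g := fun _ => 1)]
      · simp
        rfl
      · intro n hn
        rw [Set.indicator_of_mem]
        intro i hi
        exact Nat.find_min h (hi.trans_lt (Finset.mem_range.1 hn))
    · intro n hn
      rw [Set.indicator_of_notMem]
      intro hmem
      exact hmem _ (by simpa using hn) (Nat.find_spec h)
  · have h' : ¬ ∃ j, 0 ≤ j ∧ ω j ∈ ({s₀} : Set S) := by simpa using h
    dsimp only
    rw [if_neg h']
    push Not at h
    simp [Set.indicator, h]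
    rfl

/-! ### Trajectory laws: Markov property, gain and hitting times. -/

namespace FiniteMDP

variable {S A : Type*} [Fintype S]

theorem transitionMatrix_mem (M : FiniteMDP S A) (π : S → A) (s : S) :
    M.transitionMatrix π s ∈ stdSimplex ℝ S := M.p_mem s (π s)

variable [MeasurableSpace S] [DiscreteMeasurableSpace S]

instance (M : FiniteMDP S A) (π : S → A) (s : S) : IsProbabilityMeasure (M.trajMeasure π s) := by
  unfold trajMeasure; infer_instance

theorem integral_chainKernel (M : FiniteMDP S A) (π : S → A) (s : S) (u : S → ℝ) :
    ∫ x, u x ∂(M.chainKernel π s) = ((M.transitionMatrix π).mulVec u) s := by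
  change ∫ x, u x ∂((M.nextState s (π s)).toMeasure) = _
  rw [PMF.integral_eq_sum]
  refine Finset.sum_congr rfl fun x _ => ?_
  simp [nextState, transitionMatrix, ENNReal.toReal_ofReal ((M.p_mem s (π s)).1 x)]

theorem integrable_trajMeasure (M : FiniteMDP S A) (π : S → A) (s : S) (n : ℕ)
    (F : (Π _ : Finset.Iic n, S) → ℝ) :
    Integrable (fun ω => F (Preorder.frestrictLe n ω)) (M.trajMeasure π s) := by
  have : Integrable F ((M.trajMeasure π s).map (Preorder.frestrictLe n)) := Integrable.of_finite
  exact this.comp_measurable (by fun_prop)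

/-- Markov property of the state trajectory. -/
theorem integral_trajMeasure_succ (M : FiniteMDP S A) (π : S → A) (s : S) (n : ℕ)
    (F : (Π _ : Finset.Iic n, S) → ℝ) (u : S → ℝ) :
    ∫ ω, F (Preorder.frestrictLe n ω) * u (ω (n + 1)) ∂(M.trajMeasure π s) =
      ∫ ω, F (Preorder.frestrictLe n ω) * ((M.transitionMatrix π).mulVec u) (ω n)
        ∂(M.trajMeasure π s) := by
  -- The joint law of the past and the next state is the law of the past composed with the step
  -- kernel.
  have h := Kernel.partialTraj_compProd_eq_map_traj (X := fun _ => S) (κ := M.stepKernel π)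
    (Nat.zero_le n) (x₀ := fun _ => s)
  have h1 : ∫ ω, F (Preorder.frestrictLe n ω) * u (ω (n + 1)) ∂(M.trajMeasure π s) =
      ∫ z, F z.1 * u z.2 ∂((M.trajMeasure π s).map
        fun ω => (Preorder.frestrictLe (π := fun _ => S) n ω, ω (n + 1))) := by
    rw [integral_map (by fun_prop) (Measurable.of_discrete.aestronglyMeasurable)]
  have h2 : ∫ ω, F (Preorder.frestrictLe n ω) * ((M.transitionMatrix π).mulVec u) (ω n)
        ∂(M.trajMeasure π s) =
      ∫ x, F x * ((M.transitionMatrix π).mulVec u) (x ⟨n, Finset.mem_Iic.2 le_rfl⟩)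
        ∂((M.trajMeasure π s).map (Preorder.frestrictLe (π := fun _ => S) n)) := by
    rw [integral_map (by fun_prop) (Measurable.of_discrete.aestronglyMeasurable)]
    rfl
  rw [h1, h2]
  unfold trajMeasure
  rw [← h, Kernel.traj_map_frestrictLe_apply, Measure.integral_compProd Integrable.of_finite]
  refine integral_congr_ae (Eventually.of_forall fun x => ?_)
  dsimp only
  rw [integral_const_mul]
  congr 1
  exact M.integral_chainKernel π _ u

theorem integral_trajMeasure_zero (M : FiniteMDP S A) (π : S → A) (s : S) (u : S → ℝ) :
    ∫ ω, u (ω 0) ∂(M.trajMeasure π s) = u s := by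
  have h2 : ∫ ω, u (ω 0) ∂(M.trajMeasure π s) =
      ∫ x, u (x ⟨0, Finset.mem_Iic.2 le_rfl⟩)
        ∂((M.trajMeasure π s).map (Preorder.frestrictLe (π := fun _ => S) 0)) := by
    rw [integral_map (by fun_prop) (Measurable.of_discrete.aestronglyMeasurable)]
    rfl
  rw [h2]
  unfold trajMeasure
  rw [Kernel.traj_map_frestrictLe_apply, Kernel.partialTraj_self, Kernel.id_apply,
    integral_dirac]

theorem integral_trajMeasure_state_succ (M : FiniteMDP S A) (π : S → A) (s : S) (n : ℕ)
    (u : S → ℝ) :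
    ∫ ω, u (ω (n + 1)) ∂(M.trajMeasure π s) =
      ∫ ω, ((M.transitionMatrix π).mulVec u) (ω n) ∂(M.trajMeasure π s) := by
  simpa using M.integral_trajMeasure_succ π s n (fun _ => 1) u

theorem integrable_trajMeasure_state (M : FiniteMDP S A) (π : S → A) (s : S) (n : ℕ) (u : S → ℝ) :
    Integrable (fun ω => u (ω n)) (M.trajMeasure π s) :=
  M.integrable_trajMeasure π s n fun x => u (x ⟨n, Finset.mem_Iic.2 le_rfl⟩)

/-- A solution of the Poisson equation of a policy determines its gain. -/
theorem hasGain_of_poisson (M : FiniteMDP S A) (π : S → A) {g : ℝ} {h : S → ℝ}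
    (hg : ∀ s, g + h s = M.r s (π s) + ((M.transitionMatrix π).mulVec h) s) :
    M.HasGain π g := by
  intro s
  -- The Poisson equation writes each expected reward as `g` plus an increment of the expectation of
  -- `h`, so the sum telescopes.
  have hstep : ∀ n, ∫ ω, M.r (ω n) (π (ω n)) ∂(M.trajMeasure π s) =
      g + ∫ ω, h (ω n) ∂(M.trajMeasure π s) - ∫ ω, h (ω (n + 1)) ∂(M.trajMeasure π s) := by
    intro n
    rw [M.integral_trajMeasure_state_succ π s n h]
    have e : ∀ x, M.r x (π x) = (g + h x) - ((M.transitionMatrix π).mulVec h) x := fun x => by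
      linarith [hg x]
    simp_rw [e]
    rw [integral_sub (M.integrable_trajMeasure_state π s n fun x => g + h x)
      (M.integrable_trajMeasure_state π s n _), integral_add (integrable_const _)
      (M.integrable_trajMeasure_state π s n _)]
    simp
  have hsum : ∀ T : ℕ, ∑ t ∈ Finset.range T, ∫ ω, M.r (ω t) (π (ω t)) ∂(M.trajMeasure π s) =
      T * g + h s - ∫ ω, h (ω T) ∂(M.trajMeasure π s) := by
    intro T
    induction T with
    | zero => simp [M.integral_trajMeasure_zero π s h]
    | succ T ih => rw [Finset.sum_range_succ, ih, hstep]; push_cast; ring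
  have hb : ∀ T : ℕ, |h s - ∫ ω, h (ω T) ∂(M.trajMeasure π s)| ≤ ‖h‖ + ‖h‖ := by
    intro T
    refine (abs_sub _ _).trans (add_le_add (norm_le_pi_norm h s) ?_)
    have := norm_integral_le_of_norm_le_const (μ := M.trajMeasure π s) (f := fun ω => h (ω T))
      (C := ‖h‖) (Eventually.of_forall fun ω => norm_le_pi_norm h (ω T))
    simpa using this
  have hlim : Tendsto (fun T : ℕ => (1 / (T : ℝ)) *
      (h s - ∫ ω, h (ω T) ∂(M.trajMeasure π s))) atTop (𝓝 0) := by
    refine Tendsto.zero_mul_isBoundedUnder_le tendsto_one_div_atTop_nhds_zero_nat ?_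
    exact isBoundedUnder_of ⟨‖h‖ + ‖h‖, fun T => hb T⟩
  have := hlim.const_add g
  rw [add_zero] at this
  refine this.congr' ?_
  filter_upwards [eventually_gt_atTop 0] with T hT
  rw [integral_const_mul, integral_finsetSum _ fun t _ =>
    M.integrable_trajMeasure_state π s t fun x => M.r x (π x), hsum]
  have : (T : ℝ) ≠ 0 := by exact_mod_cast hT.ne'
  field_simp
  ring

/-- In an irreducible chain, the expected hitting time of `s₀` is the solution of the first-step
equations. -/
theorem expectedHittingTime_eq (M : FiniteMDP S A) (π : S → A) {s₀ : S} {u : S → ℝ}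
    (hu₀ : u s₀ = 0) (hu : ∀ s, 0 ≤ u s)
    (hstep : ∀ s, s ≠ s₀ → u s = 1 + ((M.transitionMatrix π).mulVec u) s) (s : S) :
    M.expectedHittingTime π s s₀ = ENNReal.ofReal (u s) := by
  classical
  set μ := M.trajMeasure π s
  -- Indicator of `τ > n`, as a function of the finite past. Below, `q n` is the probability of `τ >
  -- n` and `a n` the expectation of `u (ω n)` on that event.
  let F : (n : ℕ) → (Π _ : Finset.Iic n, S) → ℝ := fun n x => if ∀ i, x i ≠ s₀ then 1 else 0
  have hF : ∀ n (ω : ℕ → S), F n (Preorder.frestrictLe n ω) =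
      Set.indicator {ω : ℕ → S | ∀ i ≤ n, ω i ≠ s₀} (fun _ => (1 : ℝ)) ω := by
    intro n ω
    simp only [F, Set.indicator, Set.mem_ofPred_eq]
    exact if_congr (by simp) rfl rfl
  -- As `u` vanishes at `s₀`, requiring in addition that time `n + 1` avoid `s₀` changes nothing.
  have hFsucc : ∀ n (ω : ℕ → S), F (n + 1) (Preorder.frestrictLe (n + 1) ω) * u (ω (n + 1)) =
      F n (Preorder.frestrictLe n ω) * u (ω (n + 1)) := by
    intro n ω
    by_cases h : ω (n + 1) = s₀
    · simp [h, hu₀]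
    · congr 1
      simp only [hF, Set.indicator, Set.mem_ofPred_eq]
      congr 1
      simp only [eq_iff_iff]
      refine ⟨fun H i hi => H i (by omega), fun H i hi => ?_⟩
      rcases Nat.le_succ_iff.1 hi with hi | rfl
      · exact H i hi
      · exact h
  have hF0 : ∀ n x, 0 ≤ F n x := fun n x => by simp only [F]; split_ifs <;> simp
  set q : ℕ → ℝ := fun n => ∫ ω, F n (Preorder.frestrictLe n ω) ∂μ
  set a : ℕ → ℝ := fun n => ∫ ω, F n (Preorder.frestrictLe n ω) * u (ω n) ∂μ
  have hint : ∀ n (w : S → ℝ), Integrable (fun ω => F n (Preorder.frestrictLe n ω) * w (ω n)) μ :=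
    fun n w => M.integrable_trajMeasure π s n
      fun x => F n x * w (x ⟨n, Finset.mem_Iic.2 le_rfl⟩)
  have hq0 : ∀ n, 0 ≤ q n := fun n => integral_nonneg fun ω => hF0 n _
  have ha0 : ∀ n, 0 ≤ a n := fun n => integral_nonneg fun ω => mul_nonneg (hF0 n _) (hu _)
  have ha : ∀ n, a n = q n + a (n + 1) := by
    intro n
    simp only [a, q]
    simp_rw [hFsucc]
    rw [M.integral_trajMeasure_succ π s n (F n) u, ← integral_add
      (M.integrable_trajMeasure π s n _) (hint n _)]
    refine integral_congr_ae (Eventually.of_forall fun ω => ?_)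
    dsimp only
    by_cases h : ω n = s₀
    · have : F n (Preorder.frestrictLe n ω) = 0 := by
        rw [hF, Set.indicator_of_notMem]
        intro hmem
        exact hmem n le_rfl h
      simp [this]
    · rw [hstep _ h]; ring
  have hstart : a 0 = u s := by
    rw [← M.integral_trajMeasure_zero π s u]
    refine integral_congr_ae (Eventually.of_forall fun ω => ?_)
    dsimp only
    rw [hF]
    by_cases h : ω 0 = s₀
    · simp [h, hu₀]
    · simp [h]
  have hpart : ∀ n, ∑ k ∈ Finset.range n, q k = u s - a n := by
    intro n
    induction n with
    | zero => simp [hstart]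
    | succ n ih => rw [Finset.sum_range_succ, ih, ha n]; ring
  have hsummable : Summable q := summable_of_sum_range_le hq0 (c := u s) fun n => by
    rw [hpart]; linarith [ha0 n]
  -- The remainder `a n` vanishes because `q` is summable and `u` is bounded; hence the tail sum `∑
  -- q n` equals `u s`.
  have hale : ∀ n, a n ≤ q n * ‖u‖ := fun n => by
    simp only [a, q]
    rw [← integral_mul_const]
    exact integral_mono (hint n u) ((M.integrable_trajMeasure π s n _).mul_const _) fun ω =>
      mul_le_mul_of_nonneg_left ((le_abs_self _).trans (norm_le_pi_norm u _)) (hF0 n _)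
  have halim : Tendsto a atTop (𝓝 0) := by
    refine squeeze_zero ha0 hale ?_
    simpa using hsummable.tendsto_atTop_zero.mul_const ‖u‖
  have htsum : ∑' n, q n = u s := by
    refine tendsto_nhds_unique hsummable.hasSum.tendsto_sum_nat ?_
    simp_rw [hpart]
    simpa using halim.const_sub (u s)
  have hmeas : ∀ n, MeasurableSet {ω : ℕ → S | ∀ i ≤ n, ω i ≠ s₀} := by
    intro n
    have : {ω : ℕ → S | ∀ i ≤ n, ω i ≠ s₀} =
        (Preorder.frestrictLe (π := fun _ => S) n) ⁻¹' {x | ∀ i, x i ≠ s₀} := by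
      ext ω; simp
    rw [this]
    exact (Preorder.measurable_frestrictLe n) MeasurableSet.of_discrete
  unfold expectedHittingTime
  simp_rw [toENNReal_hittingAfter_eq_tsum]
  rw [lintegral_tsum fun n => (measurable_const.indicator (hmeas n)).aemeasurable, ← htsum,
    ENNReal.ofReal_tsum_of_nonneg hq0 hsummable]
  congr 1
  ext1 n
  rw [ofReal_integral_eq_lintegral_ofReal (M.integrable_trajMeasure π s n _)
    (Eventually.of_forall fun ω => hF0 n _)]
  refine lintegral_congr fun ω => ?_
  rw [hF]
  by_cases h : ω ∈ {ω : ℕ → S | ∀ i ≤ n, ω i ≠ s₀} <;> simp [Set.indicator, h]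

theorem worstDiameter_lt_top [Fintype A] (M : FiniteMDP S A) (hErg : M.IsErgodic) :
    M.worstDiameter < ⊤ := by
  classical
  have hfin : ∀ (π : S → A) (s s' : S), M.expectedHittingTime π s s' < ⊤ := fun π s s' => by
    obtain ⟨u, h0, hu, h1⟩ :=
      (hErg π).exists_hittingTime_solution (M.transitionMatrix_mem π) s'
    rw [M.expectedHittingTime_eq π h0 hu h1]
    exact ENNReal.ofReal_lt_top
  -- There are finitely many policies and pairs, so a finite sum dominates the supremum.
  have hle : M.worstDiameter ≤ ∑ π : S → A, ∑ s, ∑ s', M.expectedHittingTime π s s' :=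
    iSup_le fun π => iSup_le fun s => iSup_le fun s' => iSup_le fun _ => by
      refine (Finset.single_le_sum (f := fun s' => M.expectedHittingTime π s s')
        (fun _ _ => zero_le) (Finset.mem_univ s')).trans ?_
      refine (Finset.single_le_sum (f := fun s => ∑ s', M.expectedHittingTime π s s')
        (fun _ _ => zero_le) (Finset.mem_univ s)).trans ?_
      exact Finset.single_le_sum (f := fun π => ∑ s, ∑ s', M.expectedHittingTime π s s')
        (fun _ _ => zero_le) (Finset.mem_univ π)
  refine hle.trans_lt ?_
  simp only [ENNReal.sum_lt_top]
  exact fun π _ s _ s' _ => hfin π s s'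

end FiniteMDP

namespace BoundedParameterMDP

variable {S A : Type*} [Fintype S]

/-! ### Minimal averages over a set of probability vectors. -/

section SupportFunction

variable {K : Set (S → ℝ)} (hK : K ⊆ stdSimplex ℝ S)

include hK

theorem bddBelow_image_dotProduct (v : S → ℝ) : BddBelow ((fun p : S → ℝ => p ⬝ᵥ v) '' K) :=
  ⟨-‖v‖, by
    rintro _ ⟨p, hp, rfl⟩
    exact (abs_le.1 (abs_dotProduct_le_of_mem_stdSimplex (hK hp) v)).1⟩

theorem sInf_dotProduct_le {p : S → ℝ} (hp : p ∈ K) (v : S → ℝ) :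
    sInf ((fun p : S → ℝ => p ⬝ᵥ v) '' K) ≤ p ⬝ᵥ v :=
  csInf_le (bddBelow_image_dotProduct hK v) ⟨p, hp, rfl⟩

theorem le_sInf_dotProduct (hne : K.Nonempty) {v : S → ℝ} {c : ℝ} (hv : ∀ s, c ≤ v s) :
    c ≤ sInf ((fun p : S → ℝ => p ⬝ᵥ v) '' K) := by
  refine le_csInf (hne.image _) ?_
  rintro _ ⟨p, hp, rfl⟩
  exact le_dotProduct_of_mem_stdSimplex (hK hp) hv

theorem sInf_dotProduct_le_add_norm (hne : K.Nonempty) (v w : S → ℝ) :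
    sInf ((fun p : S → ℝ => p ⬝ᵥ v) '' K) ≤ sInf ((fun p : S → ℝ => p ⬝ᵥ w) '' K) + ‖v - w‖ := by
  rw [← sub_le_iff_le_add]
  refine le_csInf (hne.image _) ?_
  rintro _ ⟨p, hp, rfl⟩
  have h1 := (abs_le.1 (abs_dotProduct_le_of_mem_stdSimplex (hK hp) (v - w))).2
  rw [dotProduct_sub] at h1
  linarith [sInf_dotProduct_le hK hp v]

theorem abs_sInf_dotProduct_sub_le (hne : K.Nonempty) (v w : S → ℝ) :
    |sInf ((fun p : S → ℝ => p ⬝ᵥ v) '' K) - sInf ((fun p : S → ℝ => p ⬝ᵥ w) '' K)| ≤ ‖v - w‖ :=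
  abs_le.2 ⟨by linarith [sInf_dotProduct_le_add_norm hK hne w v, norm_sub_rev v w],
    by linarith [sInf_dotProduct_le_add_norm hK hne v w]⟩

theorem continuous_sInf_dotProduct (hne : K.Nonempty) :
    Continuous fun v : S → ℝ => sInf ((fun p : S → ℝ => p ⬝ᵥ v) '' K) :=
  (LipschitzWith.of_dist_le_mul (K := 1) fun v w => by
    rw [NNReal.coe_one, one_mul, Real.dist_eq, dist_eq_norm]
    exact abs_sInf_dotProduct_sub_le hK hne v w).continuous

theorem sInf_dotProduct_sub_const (hne : K.Nonempty) (v : S → ℝ) (c : ℝ) :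
    sInf ((fun p : S → ℝ => p ⬝ᵥ fun s => v s - c) '' K) =
      sInf ((fun p : S → ℝ => p ⬝ᵥ v) '' K) - c := by
  have e : ∀ p ∈ K, (p ⬝ᵥ fun s => v s - c) = p ⬝ᵥ v - c := fun p hp => by
    conv_rhs => rw [← dotProduct_const_of_mem_stdSimplex (hK hp) c, ← dotProduct_sub]
    rfl
  apply le_antisymm
  · rw [le_sub_iff_add_le]
    refine le_csInf (hne.image _) ?_
    rintro _ ⟨p, hp, rfl⟩
    have := sInf_dotProduct_le hK hp fun s => v s - c
    rw [e p hp] at this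
    linarith
  · refine le_csInf (hne.image _) ?_
    rintro _ ⟨p, hp, rfl⟩
    dsimp only
    rw [e p hp]
    linarith [sInf_dotProduct_le hK hp v]

end SupportFunction

/-! ### The pessimistic Bellman equation: existence, span and gain. -/

variable (B : BoundedParameterMDP S A) {M : FiniteMDP S A} (hM : M ∈ B.models) (π : S → A)

/-- The discounted pessimistic Bellman operator has a fixed point. -/
theorem exists_discounted_fixedPoint (hne : ∀ s a, (B.Bp s a).Nonempty) {γ : ℝ} (h0 : 0 ≤ γ)
    (h1 : γ < 1) :
    ∃ v : S → ℝ, ∀ s, v s = sInf (B.Br s (π s)) +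
      γ * sInf ((fun p : S → ℝ => p ⬝ᵥ v) '' B.Bp s (π s)) := by
  let T : (S → ℝ) → S → ℝ := fun v s => sInf (B.Br s (π s)) +
      γ * sInf ((fun p : S → ℝ => p ⬝ᵥ v) '' B.Bp s (π s))
  have hT : ContractingWith ⟨γ, h0⟩ T := by
    refine ⟨by exact_mod_cast h1, LipschitzWith.of_dist_le_mul fun v w => ?_⟩
    refine (dist_pi_le_iff (by positivity)).2 fun s => ?_
    rw [dist_eq_norm v w, Real.dist_eq]
    simp only [T]
    rw [add_sub_add_left_eq_sub, ← mul_sub, abs_mul, abs_of_nonneg h0]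
    exact mul_le_mul_of_nonneg_left
      (abs_sInf_dotProduct_sub_le (B.Bp_subset _ _) (hne _ _) v w) h0
  exact ⟨hT.fixedPoint, fun s => (congrFun hT.fixedPoint_isFixedPt s).symm⟩

include hM

theorem rmax_nonneg (s : S) (a : A) : 0 ≤ B.rmax := by
  have := B.Br_subset _ _ (hM s a).1
  exact this.1.trans this.2

theorem sInf_Br_nonneg (s : S) (a : A) : 0 ≤ sInf (B.Br s a) :=
  le_csInf ⟨_, (hM s a).1⟩ fun _ hr => (B.Br_subset _ _ hr).1

theorem sInf_Br_le (s : S) (a : A) : sInf (B.Br s a) ≤ M.r s a :=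
  csInf_le ⟨0, fun _ hr => (B.Br_subset _ _ hr).1⟩ (hM s a).1

theorem sInf_Br_le_rmax (s : S) (a : A) : sInf (B.Br s a) ≤ B.rmax :=
  (B.sInf_Br_le hM s a).trans (B.Br_subset _ _ (hM s a).1).2

theorem sInf_Bp_le_mulVec (v : S → ℝ) (s : S) :
    sInf ((fun p : S → ℝ => p ⬝ᵥ v) '' B.Bp s (π s)) ≤ ((M.transitionMatrix π).mulVec v) s :=
  sInf_dotProduct_le (B.Bp_subset _ _) (hM s (π s)).2 v

/-- Existence of a solution of the optimality equation of `L_π`, by the vanishing discount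
method. -/
theorem exists_bellman_solution [Nonempty S] (hirr : (M.transitionMatrix π).IsIrreducible) :
    ∃ (g : ℝ) (h : S → ℝ), ∀ s, g + h s = B.bellman π h s := by
  have hne : ∀ s a, (B.Bp s a).Nonempty := fun s a => ⟨_, (hM s a).2⟩
  obtain ⟨s₀⟩ := ‹Nonempty S›
  choose u hu₀ hu hstep using hirr.exists_hittingTime_solution (M.transitionMatrix_mem π)
  set γ : ℕ → ℝ := fun n => 1 - 1 / ((n : ℝ) + 1)
  have hγ0 : ∀ n, 0 ≤ γ n := fun n => by
    have : 1 / ((n : ℝ) + 1) ≤ 1 := by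
      rw [div_le_one (by positivity)]; linarith [Nat.cast_nonneg (α := ℝ) n]
    simp only [γ]; linarith
  have hγ1 : ∀ n, γ n < 1 := fun n => by
    have : 0 < 1 / ((n : ℝ) + 1) := by positivity
    simp only [γ]; linarith
  have hγlim : Tendsto γ atTop (𝓝 1) := by
    simpa [γ] using (tendsto_one_div_add_atTop_nhds_zero_nat (𝕜 := ℝ)).const_sub 1
  choose v hv using fun n => B.exists_discounted_fixedPoint π hne (hγ0 n) (hγ1 n)
  have hvnn : ∀ n s, 0 ≤ v n s := by
    intro n s
    have : Nonempty S := ⟨s⟩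
    obtain ⟨m, hm⟩ := Finite.exists_min (v n)
    refine le_trans ?_ (hm s)
    -- At a minimiser `m` this gives `v n m ≥ γ n * v n m`, and `γ n < 1`.
    have h1 := mul_le_mul_of_nonneg_left
      (le_sInf_dotProduct (B.Bp_subset m (π m)) (hne _ _) hm) (hγ0 n)
    nlinarith [hv n m, B.sInf_Br_nonneg hM m (π m), hγ1 n]
  -- Nonnegativity allows replacing `γ n` by 1, which makes the bound independent of the discount.
  have hdrift : ∀ n s, v n s ≤ B.rmax + ((M.transitionMatrix π).mulVec (v n)) s := by
    intro n s
    have h1 : 0 ≤ sInf ((fun p : S → ℝ => p ⬝ᵥ v n) '' B.Bp s (π s)) :=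
      le_sInf_dotProduct (B.Bp_subset _ _) (hne _ _) (hvnn n)
    have h2 := mul_le_of_le_one_left h1 (hγ1 n).le
    linarith [hv n s, B.sInf_Bp_le_mulVec hM π (v n) s, B.sInf_Br_le_rmax hM s (π s)]
  have hspan : ∀ n s t, v n s - v n t ≤ B.rmax * u t s := fun n s t =>
    hirr.sub_le_mul_hittingTime (M.transitionMatrix_mem π) (hu₀ t) (hstep t)
      (fun s _ => hdrift n s) s
  let w : ℕ → S → ℝ := fun n s => v n s - v n s₀
  let m : S → (S → ℝ) → ℝ := fun s x => sInf ((fun p : S → ℝ => p ⬝ᵥ x) '' B.Bp s (π s))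
  have hmc : ∀ s, Continuous (m s) := fun s =>
    continuous_sInf_dotProduct (B.Bp_subset _ _) (hne _ _)
  -- Normalising at `s₀` turns the discounted equation into one whose constant, `(1 - γ n) * v n
  -- s₀`, is rewritten through `w n`; it therefore converges along with `w`.
  have hw : ∀ n s, sInf (B.Br s₀ (π s₀)) + γ n * m s₀ (w n) + w n s =
      sInf (B.Br s (π s)) + γ n * m s (w n) := by
    intro n s
    have e : ∀ s, m s (w n) = m s (v n) - v n s₀ := fun s =>
      sInf_dotProduct_sub_const (B.Bp_subset _ _) (hne _ _) (v n) (v n s₀)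
    rw [e, e]
    simp only [w]
    linarith [hv n s, hv n s₀]
  obtain ⟨h, -, φ, hφ, hlim⟩ := (isCompact_univ_pi fun s =>
      isCompact_Icc (a := -(B.rmax * u s s₀)) (b := B.rmax * u s₀ s)).tendsto_subseq (x := w)
    fun n s _ => ⟨by linarith [hspan n s₀ s], hspan n s s₀⟩
  have hγφ := hγlim.comp hφ.tendsto_atTop
  refine ⟨sInf (B.Br s₀ (π s₀)) + m s₀ h, h, fun s => ?_⟩
  have hm : ∀ s, Tendsto (fun n => γ (φ n) * m s (w (φ n))) atTop (𝓝 (m s h)) := fun s => by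
    simpa using hγφ.mul (((hmc s).tendsto h).comp hlim)
  refine tendsto_nhds_unique (((hm s₀).const_add _).add ((tendsto_pi_nhds.1 hlim) s)) ?_
  refine ((hm s).const_add (sInf (B.Br s (π s)))).congr fun n => ?_
  exact (hw (φ n) s).symm

/-- The span of the bias of `L_π` is controlled by the mean hitting times. -/
theorem vecSpan_le_of_bellman [Nonempty S] [MeasurableSpace S] [DiscreteMeasurableSpace S]
    [Fintype A] (hErg : M.IsErgodic) {g : ℝ} {h : S → ℝ} (hg : ∀ s, g + h s = B.bellman π h s) :
    vecSpan h ≤ B.rmax * M.worstDiameter.toReal := by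
  obtain ⟨i, hi⟩ := Finite.exists_min h
  obtain ⟨j, hj⟩ := Finite.exists_max h
  have hspan : vecSpan h ≤ h j - h i := sub_le_sub (ciSup_le hj) (le_ciInf hi)
  refine hspan.trans ?_
  have hr := B.rmax_nonneg hM i (π i)
  -- The diameter only involves distinct states, so constant `h` is treated apart.
  by_cases hij : j = i
  · rw [hij, sub_self]
    positivity
  -- At the minimiser `i` every average of `h` is at least `h i`, so `g` is at least the minimal
  -- reward. This lets `g` be dropped from the drift bound.
  have hg0 : 0 ≤ g := by
    have h1 := le_sInf_dotProduct (B.Bp_subset i (π i)) ⟨_, (hM i (π i)).2⟩ hi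
    have h2 := hg i
    simp only [bellman] at h2
    linarith [B.sInf_Br_nonneg hM i (π i)]
  obtain ⟨u, hu₀, hu, hstep⟩ :=
    (hErg π).exists_hittingTime_solution (M.transitionMatrix_mem π) i
  refine ((hErg π).sub_le_mul_hittingTime (M.transitionMatrix_mem π) (c := B.rmax) hu₀ hstep
    (fun s _ => ?_) j).trans (mul_le_mul_of_nonneg_left ?_ hr)
  · have h2 := hg s
    simp only [bellman] at h2
    linarith [B.sInf_Bp_le_mulVec hM π h s, B.sInf_Br_le_rmax hM s (π s)]
  · rw [← ENNReal.ofReal_le_iff_le_toReal (M.worstDiameter_lt_top hErg).ne,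
      ← M.expectedHittingTime_eq π hu₀ hu hstep]
    exact le_iSup_of_le π <| le_iSup_of_le j <| le_iSup_of_le i <|
      le_iSup_of_le (f := fun _ => M.expectedHittingTime π j i) hij le_rfl

/-- The pessimistic gain is at most the gain of the policy in any model. -/
theorem gain_le_of_bellman [Nonempty S] {g g' : ℝ} {h h' : S → ℝ}
    (hg : ∀ s, g + h s = B.bellman π h s)
    (hg' : ∀ s, g' + h' s = M.r s (π s) + ((M.transitionMatrix π).mulVec h') s) : g ≤ g' := by
  -- At `j` averaging cannot increase `h - h'`, while the two equations give `g - g' ≤ P (h - h') j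
  -- - (h - h') j`.
  obtain ⟨j, hj⟩ := Finite.exists_max (h - h')
  have h1 := dotProduct_le_of_mem_stdSimplex (M.transitionMatrix_mem π j) hj
  have h2 : M.transitionMatrix π j ⬝ᵥ (h - h') =
    ((M.transitionMatrix π).mulVec h) j - ((M.transitionMatrix π).mulVec h') j :=
    dotProduct_sub _ _ _
  have h3 := hg j
  simp only [bellman] at h3
  rw [h2, Pi.sub_apply] at h1
  linarith [hg' j, B.sInf_Bp_le_mulVec hM π h j, B.sInf_Br_le hM j (π j)]

end BoundedParameterMDP

/-! ### Poisson equation of a single model and conclusion. -/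

theorem isPolytope_singleton {E : Type*} [AddCommGroup E] [Module ℝ E] (x : E) :
    IsPolytope ({x} : Set E) :=
  ⟨{x}, Set.finite_singleton x, (convexHull_singleton x).symm⟩

/-- The Poisson equation of an irreducible policy in a model with rewards in `[0, c]` has a
solution. -/
theorem FiniteMDP.exists_poisson_solution {S A : Type*} [Fintype S] [Nonempty S]
    (M : FiniteMDP S A) {c : ℝ} (hr : ∀ s a, M.r s a ∈ Set.Icc 0 c) (π : S → A)
    (hirr : (M.transitionMatrix π).IsIrreducible) :
    ∃ (g : ℝ) (h : S → ℝ), ∀ s, g + h s = M.r s (π s) + ((M.transitionMatrix π).mulVec h) s := by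
  let B : BoundedParameterMDP S A :=
    { rmax := c
      Br := fun s a => {M.r s a}
      Bp := fun s a => {M.p s a}
      Br_subset := fun s a => Set.singleton_subset_iff.2 (hr s a)
      Bp_subset := fun s a => Set.singleton_subset_iff.2 (M.p_mem s a)
      Br_polytope := fun _ _ => isPolytope_singleton _
      Bp_polytope := fun _ _ => isPolytope_singleton _ }
  obtain ⟨g, h, hg⟩ := B.exists_bellman_solution (M := M) (fun _ _ => ⟨rfl, rfl⟩) π hirr
  refine ⟨g, h, fun s => (hg s).trans ?_⟩
  simp only [BoundedParameterMDP.bellman, B, Set.image_singleton, csInf_singleton]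
  rfl

theorem mainTheorem4 {S A : Type*} [Fintype S] [Nonempty S] [Fintype A]
    [MeasurableSpace S] [DiscreteMeasurableSpace S]
    (B : BoundedParameterMDP S A) (M : FiniteMDP S A) (hM : M ∈ B.models)
    (hErg : M.IsErgodic) (π : S → A) :
    (∃ (g : ℝ) (h : S → ℝ), ∀ s, g + h s = B.bellman π h s) ∧
    M.worstDiameter < ⊤ ∧
    ∃ gπ : ℝ, M.HasGain π gπ ∧
      ∀ (g : ℝ) (h : S → ℝ), (∀ s, g + h s = B.bellman π h s) →
        g ≤ gπ ∧ vecSpan h ≤ B.rmax * M.worstDiameter.toReal := by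
  obtain ⟨gπ, hπ, hpoisson⟩ :=
    M.exists_poisson_solution (fun s a => B.Br_subset s a (hM s a).1) π (hErg π)
  exact ⟨B.exists_bellman_solution hM π (hErg π), M.worstDiameter_lt_top hErg, gπ,
    M.hasGain_of_poisson π hpoisson, fun g h hg =>
      ⟨B.gain_le_of_bellman hM π hg hpoisson, B.vecSpan_le_of_bellman hM π hErg hg⟩⟩
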